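/- Let $\Lambda$ be an artin algebra, i.e. an algebra over a commutative artinian ring $R$ that is finitely generated as an $R$-module, and let $\mathrm{mod}\text{-}\Lambda$ be the category of finitely generated $\Lambda$-modules. Let $n \geq 1$ be an integer and let $\mathcal{M}$ be an $n$-cluster tilting subcategory of $\mathrm{mod}\text{-}\Lambda$: a full additive subcategory, closed under isomorphisms, which is functorially finite (every $X$ in $\mathrm{mod}\text{-}\Lambda$ has a right $\mathcal{M}$-approximation, i.e. a morphism $M \to X$ with $M \in \mathcal{M}$ through which every morphism $M' \to X$ with $M' \in \mathcal{M}$ factors, and dually a left $\mathcal{M}$-approximation), generating and cogenerating (every $X$ in $\mathrm{mod}\text{-}\Lambda$ is a quotient of an object of $\mathcal{M}$ and embeds in an object of $\mathcal{M}$), and which satisfies $$\mathcal{M} = \{X \in \mathrm{mod}\text{-}\Lambda \mid \mathrm{Ext}^i_\Lambda(\mathcal{M}, X) = 0 \text{ for } 0<i<n\} = \{X \in \mathrm{mod}\text{-}\Lambda \mid \mathrm{Ext}^i_\Lambda(X, \mathcal{M}) = 0 \text{ for } 0<i<n\}.$$ Let $A \in \mathcal{M}$. (i) If a functor $F$ from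 $\mathcal{M}$ to abelian groups is a direct summand of the covariant functor $\mathrm{Ext}^n_\Lambda(A,-)|_{\mathcal{M}}$, then there exists $B \in \mathcal{M}$ such that $F \cong \mathrm{Ext}^n_\Lambda(B,-)|_{\mathcal{M}}$. (ii) If a functor $F$ from $\mathcal{M}^{\mathrm{op}}$ to abelian groups is a direct summand of the contravariant functor $\mathrm{Ext}^n_\Lambda(-,A)|_{\mathcal{M}}$, then there exists $B \in \mathcal{M}$ such that $F \cong \mathrm{Ext}^n_\Lambda(-,B)|_{\mathcal{M}}$. -/

import Mathlib

open CategoryTheory CategoryTheory.Limits CategoryTheory.Abelian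

universe u

namespace HigherCT

variable {Λ : Type u} [Ring Λ]

/-- `π : N ⟶ X` is a right `M`-approximation of `X`: `N` lies in `M`, and every morphism to `X`
from an object of `M` factors through `π`. -/
def IsRightApprox (M : ObjectProperty (ModuleCat.{u} Λ)) {N X : ModuleCat.{u} Λ}
    (π : N ⟶ X) : Prop :=
  M N ∧ ∀ (N' : ModuleCat.{u} Λ), M N' → ∀ f : N' ⟶ X, ∃ g : N' ⟶ N, g ≫ π = f

/-- `ι : X ⟶ N` is a left `M`-approximation of `X`: `N` lies in `M`, and every morphism from `X`
to an object of `M` factors through `ι`. -/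
def IsLeftApprox (M : ObjectProperty (ModuleCat.{u} Λ)) {X N : ModuleCat.{u} Λ}
    (ι : X ⟶ N) : Prop :=
  M N ∧ ∀ (N' : ModuleCat.{u} Λ), M N' → ∀ f : X ⟶ N', ∃ g : N ⟶ N', ι ≫ g = f

/-- A full subcategory `M` of `mod Λ`, the category of finitely generated `Λ`-modules, is
`n`-cluster tilting. The subcategory is given by a property of `Λ`-modules that implies finite
generation, and `Ext` is the usual `Ext` over the ring `Λ`. -/
structure IsNClusterTilting (n : ℕ) (M : ObjectProperty (ModuleCat.{u} Λ)) : Prop where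
  /-- `M` is a subcategory of `mod Λ`. -/
  le_isFG : M ≤ ModuleCat.isFG Λ
  /-- `M` is closed under isomorphisms. -/
  of_iso : ∀ {X Y : ModuleCat.{u} Λ}, (X ≅ Y) → M X → M Y
  /-- `M` is additive: it contains the zero modules and is closed under direct sums. -/
  zero : ∀ X : ModuleCat.{u} Λ, IsZero X → M X
  biprod : ∀ X Y : ModuleCat.{u} Λ, M X → M Y → M (X ⊞ Y)
  /-- `M` is contravariantly finite in `mod Λ`. -/
  contravariantlyFinite : ∀ X : ModuleCat.{u} Λ, Module.Finite Λ X →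
    ∃ (N : ModuleCat.{u} Λ) (π : N ⟶ X), IsRightApprox M π
  /-- `M` is covariantly finite in `mod Λ`. -/
  covariantlyFinite : ∀ X : ModuleCat.{u} Λ, Module.Finite Λ X →
    ∃ (N : ModuleCat.{u} Λ) (ι : X ⟶ N), IsLeftApprox M ι
  /-- `M` is generating in `mod Λ`. -/
  generating : ∀ X : ModuleCat.{u} Λ, Module.Finite Λ X →
    ∃ (N : ModuleCat.{u} Λ) (π : N ⟶ X), M N ∧ Epi π
  /-- `M` is cogenerating in `mod Λ`. -/
  cogenerating : ∀ X : ModuleCat.{u} Λ, Module.Finite Λ X →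
    ∃ (N : ModuleCat.{u} Λ) (ι : X ⟶ N), M N ∧ Mono ι
  /-- `M` consists of the `X` in `mod Λ` with `Ext^i(M, X) = 0` for `0 < i < n`. -/
  mem_iff_right : ∀ X : ModuleCat.{u} Λ, Module.Finite Λ X →
    (M X ↔ ∀ Y : ModuleCat.{u} Λ, M Y → ∀ i : ℕ, 0 < i → i < n → Subsingleton (Ext Y X i))
  /-- `M` consists of the `X` in `mod Λ` with `Ext^i(X, M) = 0` for `0 < i < n`. -/
  mem_iff_left : ∀ X : ModuleCat.{u} Λ, Module.Finite Λ X →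
    (M X ↔ ∀ Y : ModuleCat.{u} Λ, M Y → ∀ i : ℕ, 0 < i → i < n → Subsingleton (Ext X Y i))

/-- The functor `Ext^n(A, -)` restricted to the full subcategory `M`. -/
noncomputable def extFrom (M : ObjectProperty (ModuleCat.{u} Λ)) (n : ℕ) (A : ModuleCat.{u} Λ) :
    M.FullSubcategory ⥤ AddCommGrpCat.{u} :=
  M.ι ⋙ (extFunctor.{u} n).obj (Opposite.op A)

/-- The functor `Ext^n(-, A)` restricted to the full subcategory `M`. -/
noncomputable def extTo (M : ObjectProperty (ModuleCat.{u} Λ)) (n : ℕ) (A : ModuleCat.{u} Λ) :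
    M.FullSubcategoryᵒᵖ ⥤ AddCommGrpCat.{u} :=
  M.ι.op ⋙ (extFunctor.{u} n).flip.obj A

/-- `F` is a direct summand of `E`, for functors with values in abelian groups. (If `E` is
additive, then so are both summands.) -/
def IsDirectSummand {C : Type*} [Category C] (F E : C ⥤ AddCommGrpCat.{u}) : Prop :=
  ∃ G : C ⥤ AddCommGrpCat.{u}, Nonempty (E ≅ F ⊞ G)

end HigherCT

/-! Splice an epimorphism from a projective onto `A` with successive right `M`-approximations of
kernels into an exact sequence from `K` to `A` with `n` middle terms in `M`. Dimension shifting puts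
`K` in `M`, and the class `ξ` in `Ext^n(A, K)` generates: each element of `Ext^n(A, X)` is `ξ`
followed by a morphism `K ⟶ X`. An endomorphism `η` of `Ext^n(A, -)` is thus determined by `η ξ`,
which dies in the last middle term and so comes from an endomorphism of `A`
(`exists_eq_extFromMap`). The contravariant case is dual and starts from a finitely generated
injective (`exists_mono_finite_injective`); this uses that `Λ` is an artin algebra.

A direct summand of `Ext^n(A, -)` is the image of an idempotent, hence is induced by some `f : A ⟶
A`, not necessarily idempotent. All positive powers of `f` induce it too. By Fitting, one of them is
invertible on the image of an idempotent `e` of `A`, and `e` induces the same transformation. The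
object `B` splitting `e` is the one sought. -/

namespace HigherCT

/-! ### Idempotents -/

/-- Fitting: some power `g` of an endomorphism `f` of a module of finite length is invertible on the
image of an idempotent `e` with `g ≫ e = g`. The predicate `p` stands for the properties that all
powers of `f` share. -/
theorem exists_idempotent_factor {Λ : Type u} [Ring Λ] (A : ModuleCat.{u} Λ) [IsArtinian Λ A]
    [IsNoetherian Λ A] (f : A ⟶ A) (p : (A ⟶ A) → Prop) (hf : p f)
    (hp : ∀ g, p g → p (g ≫ f)) :
    ∃ g e b : A ⟶ A, p g ∧ e ≫ e = e ∧
      g ≫ b = e ∧ b ≫ g = e ∧ g ≫ e = g ∧ e ≫ g = g := by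
  obtain ⟨N, hN⟩ := (LinearMap.eventually_isCompl_ker_pow_range_pow f.hom).exists_forall_of_atTop
  -- The exponent is positive because `p` is assumed for `f` but not for the identity.
  have hc := hN (N + 1) (by lia)
  set G : Module.End Λ A := f.hom ^ (N + 1) with hG
  have hker : ∀ x, G (G x) = 0 → G x = 0 := fun x hx ↦
    (Submodule.disjoint_def.1 hc.disjoint) (G x) hx ⟨x, rfl⟩
  have hsurj : ∀ x, ∃ y, G (G y) = G x := fun x ↦ by
    obtain ⟨k, hk, r, ⟨y, rfl⟩, h⟩ := Submodule.mem_sup.1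
      (show x ∈ _ ⊔ _ by rw [hc.sup_eq_top]; trivial)
    exact ⟨y, by rw [← h, map_add, LinearMap.mem_ker.1 hk, zero_add]⟩
  let G' : LinearMap.range G →ₗ[Λ] LinearMap.range G := G.restrict (fun x _ ↦ ⟨x, rfl⟩)
  have hbij : Function.Bijective G' := by
    constructor
    · rw [← LinearMap.ker_eq_bot, LinearMap.ker_eq_bot']
      rintro ⟨_, x, rfl⟩ hx
      exact Subtype.ext (hker x (congrArg Subtype.val hx))
    · rintro ⟨_, x, rfl⟩
      obtain ⟨y, hy⟩ := hsurj x
      exact ⟨⟨G y, y, rfl⟩, Subtype.ext hy⟩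
  let I := (LinearEquiv.ofBijective G' hbij).symm
  have hI : ∀ x, G (I x : A) = x := fun x ↦
    congrArg Subtype.val ((LinearEquiv.ofBijective G' hbij).apply_symm_apply x)
  -- `P` is the projection onto the range of `G` along its kernel; it gives `e`.
  let P : A →ₗ[Λ] LinearMap.range G := I ∘ₗ G.rangeRestrict
  have hP : ∀ x, G (P x : A) = G x := fun x ↦ hI _
  have hPr : ∀ x : LinearMap.range G, P x = x := fun x ↦
    (LinearEquiv.ofBijective G' hbij).symm_apply_apply x
  have hGP : ∀ x, (P (G x) : A) = G x := fun x ↦ congrArg Subtype.val (hPr ⟨G x, x, rfl⟩)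
  let B : A →ₗ[Λ] A := (LinearMap.range G).subtype ∘ₗ I.toLinearMap ∘ₗ P
  have hpG : ∀ k, p (ModuleCat.ofHom (f.hom ^ (k + 1))) := fun k ↦ by
    induction k with
    | zero => rw [zero_add, pow_one]; exact hf
    | succ k ih => rw [pow_succ']; exact hp _ ih
  refine ⟨ModuleCat.ofHom G, ModuleCat.ofHom ((LinearMap.range G).subtype ∘ₗ P),
    ModuleCat.ofHom B, hpG N, ?_, ?_, ?_, ?_, ?_⟩
  · ext x; exact congrArg Subtype.val (hPr (P x))
  · ext x
    change (I (P (G x)) : A) = I (G.rangeRestrict x)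
    congr 2
    exact Subtype.ext (hGP x)
  · ext x; exact hI _
  · ext x; exact hGP x
  · ext x; exact hP x

/-- Two splittings of an idempotent are isomorphic. -/
def isoOfSplittings {C : Type*} [Category C] {E F H : C} (i : F ⟶ E) (r : E ⟶ F) (j : H ⟶ E)
    (s : E ⟶ H) (hF : i ≫ r = 𝟙 F) (hH : j ≫ s = 𝟙 H) (h : r ≫ i = s ≫ j) : F ≅ H where
  hom := i ≫ s
  inv := j ≫ r
  hom_inv_id := by
    rw [Category.assoc, ← Category.assoc s, ← h]; simp [hF]
  inv_hom_id := by
    rw [Category.assoc, ← Category.assoc r, h]; simp [hH]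

/-! ### Finitely generated injectives over an artin algebra -/

theorem isArtinianRing_of_finite (R : Type*) [CommRing R] [IsArtinianRing R]
    (Λ : Type u) [Ring Λ] [Algebra R Λ] [Module.Finite R Λ] : IsArtinianRing Λ :=
  isArtinian_of_tower R inferInstance

theorem isNoetherianRing_of_finite (R : Type*) [CommRing R] [IsArtinianRing R]
    (Λ : Type u) [Ring Λ] [Algebra R Λ] [Module.Finite R Λ] : IsNoetherianRing Λ :=
  isNoetherian_of_tower R inferInstance

/-- Over an artin algebra, a submodule in which a finitely generated submodule is essential is
finitely generated. -/
theorem finite_of_essential {R : Type*} [CommRing R] [IsArtinianRing R]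
    {Λ : Type u} [Ring Λ] [Algebra R Λ] [Module.Finite R Λ]
    {Q : Type*} [AddCommGroup Q] [Module Λ Q] [Module R Q] [IsScalarTower R Λ Q]
    (A E : Submodule Λ Q) (hA : A.FG)
    (hess : ∀ x ∈ E, x ≠ 0 → ∃ r : Λ, r • x ≠ 0 ∧ r • x ∈ A) : E.FG := by
  have := isArtinianRing_of_finite R Λ
  have := isNoetherianRing_of_finite R Λ
  have hcomm : ∀ (r : R) (a : Λ) (x : Q), a • r • x = r • a • x := fun r a x ↦ by
    rw [← algebraMap_smul Λ r x, smul_smul, ← Algebra.commutes, ← smul_smul, algebraMap_smul]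
  -- The part of `E` killed by `J`. Descending from `J = ⊤` to `J = ⊥` along covers shows that it is
  -- noetherian over `R`.
  let ann (J : Submodule Λ Λ) : Submodule R Q :=
    { carrier := {x | x ∈ E ∧ ∀ j ∈ J, j • x = 0}
      zero_mem' := ⟨E.zero_mem, fun j _ ↦ smul_zero j⟩
      add_mem' := fun {x y} hx hy ↦ ⟨E.add_mem hx.1 hy.1, fun j hj ↦ by
        rw [smul_add, hx.2 j hj, hy.2 j hj, add_zero]⟩
      smul_mem' := fun r x hx ↦ ⟨E.smul_of_tower_mem r hx.1, fun j hj ↦ by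
        rw [hcomm, hx.2 j hj, smul_zero]⟩ }
  have hAR : IsNoetherian R (A.restrictScalars R) := by
    have : Module.Finite Λ A := Module.Finite.iff_fg.2 hA
    have : Module.Finite R A := Module.Finite.trans Λ A
    exact isNoetherian_of_isNoetherianRing_of_finite R A
  have key : ∀ J : Submodule Λ Λ, IsNoetherian R (ann J) := by
    intro J
    induction J using WellFoundedGT.induction with
    | ind J ih =>
      by_cases hJ : J = ⊤
      · have hbot : ann J = ⊥ := by
          rw [eq_bot_iff]
          intro x hx
          have := hx.2 1 (hJ ▸ Submodule.mem_top)
          rwa [one_smul] at this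
        rw [hbot]; infer_instance
      · obtain ⟨J', hJJ', -⟩ := exists_covBy_le_of_lt (lt_top_iff_ne_top.2 hJ)
        obtain ⟨a, haJ', haJ⟩ := SetLike.exists_of_lt hJJ'.lt
        -- `J' / J` is simple, so any `c` outside `J` generates it.
        have hspan : ∀ c ∈ J', c ∉ J → ∀ d ∈ J', ∃ m : Λ, d - m * c ∈ J := by
          intro c hc hcJ d hd
          have hle : J ⊔ Submodule.span Λ {c} = J' := by
            refine (hJJ'.eq_or_eq le_sup_left
              (sup_le hJJ'.le (by simpa using hc))).resolve_left fun h ↦ hcJ ?_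
            rw [← h]
            exact Submodule.mem_sup_right (Submodule.mem_span_singleton_self c)
          rw [← hle] at hd
          obtain ⟨j, hj, y, hy, rfl⟩ := Submodule.mem_sup.1 hd
          obtain ⟨m, rfl⟩ := Submodule.mem_span_singleton.1 hy
          exact ⟨m, by simpa using hj⟩
        -- If `a • x ≠ 0`, essentiality gives `r * a` outside `J` sending `x` into `A`; modulo `J`,
        -- `a` is a multiple of `r * a`.
        have hmem : ∀ x ∈ ann J, a • x ∈ A := by
          intro x hx
          by_cases h0 : a • x = 0
          · rw [h0]; exact A.zero_mem
          obtain ⟨r, hr0, hrA⟩ := hess (a • x) (E.smul_mem a hx.1) h0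
          rw [smul_smul] at hr0 hrA
          obtain ⟨m, hm⟩ := hspan (r * a) (J'.smul_mem r haJ')
            (fun h ↦ hr0 (hx.2 _ h)) a haJ'
          have := hx.2 _ hm
          rw [sub_smul, sub_eq_zero, mul_smul] at this
          rw [this]
          exact A.smul_mem m hrA
        let φ : ann J →ₗ[R] A.restrictScalars R :=
          { toFun := fun x ↦ ⟨a • (x : Q), hmem x x.2⟩
            map_add' := fun x y ↦ Subtype.ext (smul_add a _ _)
            map_smul' := fun r x ↦ Subtype.ext (hcomm r a x) }
        have hle : ann J' ≤ ann J := fun x hx ↦ ⟨hx.1, fun j hj ↦ hx.2 j (hJJ'.le hj)⟩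
        have := ih J' hJJ'.lt
        -- Multiplication by `a` maps `ann J` to `A` with kernel `ann J'`, since `a` generates `J'`
        -- modulo `J`.
        refine isNoetherian_of_range_eq_ker (Submodule.inclusion hle) φ ?_
        ext x
        constructor
        · rintro ⟨y, rfl⟩
          exact Subtype.ext (y.2.2 a haJ')
        · intro hx
          have hax : a • (x : Q) = 0 := congrArg Subtype.val hx
          refine ⟨⟨x, x.2.1, fun d hd ↦ ?_⟩, rfl⟩
          obtain ⟨m, hm⟩ := hspan a haJ' haJ d hd
          have := x.2.2 _ hm
          rwa [sub_smul, mul_smul, hax, smul_zero, sub_zero] at this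
  have hbot : ann ⊥ = E.restrictScalars R := by
    ext x
    exact ⟨fun hx ↦ hx.1, fun hx ↦ ⟨hx, fun j hj ↦ by
      rw [(Submodule.mem_bot Λ).1 hj, zero_smul]⟩⟩
  have hE : IsNoetherian R (E.restrictScalars R) := hbot ▸ key ⊥
  exact .of_restrictScalars R (Module.Finite.iff_fg.1 inferInstance)

/-- In an injective module, every submodule is essential in a submodule that is a retract. -/
theorem exists_essential_retract {Λ : Type u} [Ring Λ] {Q : Type u} [AddCommGroup Q] [Module Λ Q]
    (hQ : Module.Injective Λ Q) (A : Submodule Λ Q) :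
    ∃ E : Submodule Λ Q, A ≤ E ∧ (∀ x ∈ E, x ≠ 0 → ∃ r : Λ, r • x ≠ 0 ∧ r • x ∈ A) ∧
      ∃ π : Q →ₗ[Λ] E, ∀ x : E, π x = x := by
  obtain ⟨E, hAE, hE⟩ := zorn_le_nonempty₀
    {H : Submodule Λ Q | A ≤ H ∧ ∀ x ∈ H, x ≠ 0 → ∃ r : Λ, r • x ≠ 0 ∧ r • x ∈ A}
    (fun c hc hchain y hy ↦ ⟨sSup c, ⟨(hc hy).1.trans (le_sSup hy), fun x hx ↦ by
      obtain ⟨H, hH, hxH⟩ := (Submodule.mem_sSup_of_directed ⟨y, hy⟩ hchain.directedOn).1 hx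
      exact (hc hH).2 x hxH⟩, fun z hz ↦ le_sSup hz⟩)
    A ⟨le_rfl, fun x hx h0 ↦ ⟨1, by rwa [one_smul], by rwa [one_smul]⟩⟩
  -- For `K` maximal among the submodules disjoint from `E`, the image of `E` in `Q / K` is
  -- essential.
  obtain ⟨K, -, hK⟩ := zorn_le_nonempty₀ {K : Submodule Λ Q | Disjoint K E}
    (fun c hc hchain y hy ↦ ⟨sSup c, by
      rw [Set.mem_ofPred_eq, Submodule.disjoint_def]
      intro x hx hxE
      obtain ⟨H, hH, hxH⟩ := (Submodule.mem_sSup_of_directed ⟨y, hy⟩ hchain.directedOn).1 hx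
      exact Submodule.disjoint_def.1 (hc hH) x hxH hxE, fun z hz ↦ le_sSup hz⟩)
    ⊥ disjoint_bot_left
  have hKE := Submodule.disjoint_def.1 hK.prop
  obtain ⟨φ, hφ⟩ := hQ.out (K.mkQ ∘ₗ E.subtype) (by
    rw [← LinearMap.ker_eq_bot, LinearMap.ker_eq_bot']
    intro x hx
    exact Subtype.ext (hKE x ((Submodule.Quotient.mk_eq_zero K).1 hx) x.2)) E.subtype
  have hφE : ∀ x ∈ E, φ (K.mkQ x) = x := fun x hx ↦ hφ ⟨x, hx⟩
  have hmeet : ∀ q : Q, q ∉ K → ∃ r : Λ, ∃ y ∈ E, y ≠ 0 ∧ K.mkQ (r • q) = K.mkQ y := by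
    intro q hq
    have hnd : ¬ Disjoint (K ⊔ Submodule.span Λ {q}) E := fun h ↦ hq <|
      hK.le_of_ge h le_sup_left
        (Submodule.mem_sup_right (Submodule.mem_span_singleton_self q))
    rw [Submodule.disjoint_def] at hnd
    push Not at hnd
    obtain ⟨y, hy, hyE, hy0⟩ := hnd
    obtain ⟨k, hk, z, hz, rfl⟩ := Submodule.mem_sup.1 hy
    obtain ⟨r, rfl⟩ := Submodule.mem_span_singleton.1 hz
    refine ⟨r, _, hyE, hy0, ?_⟩
    rw [map_add, (show K.mkQ k = 0 from (Submodule.Quotient.mk_eq_zero K).2 hk), zero_add]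
  -- `A` is essential in this range, which contains `E`; maximality of `E` gives equality.
  have hrange : LinearMap.range (φ ∘ₗ K.mkQ) ≤ E := by
    refine hE.le_of_ge ⟨hE.prop.1.trans fun x hx ↦ ⟨x, hφE x hx⟩, ?_⟩
      fun x hx ↦ ⟨x, hφE x hx⟩
    rintro _ ⟨q, rfl⟩ h0
    have hq : q ∉ K := fun h ↦ h0 (by
      rw [LinearMap.comp_apply, (show K.mkQ q = 0 from (Submodule.Quotient.mk_eq_zero K).2 h),
        map_zero])
    obtain ⟨r, y, hyE, hy0, hry⟩ := hmeet q hq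
    obtain ⟨t, ht0, htA⟩ := hE.prop.2 y hyE hy0
    have : (t * r) • (φ ∘ₗ K.mkQ) q = t • y := by
      rw [mul_smul, ← map_smul, LinearMap.comp_apply, hry, hφE y hyE]
    exact ⟨t * r, by rwa [this], by rwa [this]⟩
  exact ⟨E, hE.prop.1, hE.prop.2, LinearMap.codRestrict E (φ ∘ₗ K.mkQ) fun x ↦ hrange ⟨x, rfl⟩,
    fun x ↦ Subtype.ext (hφE x x.2)⟩

/-- The category of finitely generated modules over an artin algebra has enough injectives. -/
theorem exists_mono_finite_injective (R : Type*) [CommRing R] [IsArtinianRing R]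
    {Λ : Type u} [Ring Λ] [Algebra R Λ] [Module.Finite R Λ] (A : ModuleCat.{u} Λ)
    [Module.Finite Λ A] :
    ∃ (I : ModuleCat.{u} Λ) (i : A ⟶ I), Mono i ∧ Injective I ∧ Module.Finite Λ I := by
  let Q : ModuleCat.{u} Λ := Injective.under A
  let ι : A ⟶ Q := Injective.ι A
  let _ : Module R Q := Module.compHom Q (algebraMap R Λ)
  have : IsScalarTower R Λ Q := ⟨fun r a x ↦ by
    rw [Algebra.smul_def, mul_smul]; rfl⟩
  have hQ : Injective (ModuleCat.of Λ Q) := Injective.injective_under A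
  obtain ⟨E, hAE, hess, π, hπ⟩ := exists_essential_retract
    (Module.injective_module_of_injective_object Λ Q) (LinearMap.range ι.hom)
  refine ⟨ModuleCat.of Λ E,
    ModuleCat.ofHom (LinearMap.codRestrict E ι.hom fun x ↦ hAE ⟨x, rfl⟩), ?_, ?_, ?_⟩
  · rw [ModuleCat.mono_iff_injective]
    intro x y hxy
    exact (ModuleCat.mono_iff_injective ι).1 inferInstance (congrArg Subtype.val hxy)
  · have r : Retract (ModuleCat.of Λ E) Q :=
      { i := ModuleCat.ofHom E.subtype
        r := ModuleCat.ofHom π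
        retract := by
          ext x
          exact congrArg Subtype.val (hπ x) }
    exact r.injective
  · refine Module.Finite.iff_fg.2 (finite_of_essential (R := R) _ E ?_ hess)
    exact Module.Finite.iff_fg.1 (Module.Finite.range ι.hom)

/-! ### Exact sequences of modules -/

section Modules

variable {Λ : Type u} [Ring Λ]

/-- The `Ext` class of a short exact sequence, with the exactness properties of the long exact
sequences. -/
theorem exists_extClass {Z X Y : ModuleCat.{u} Λ} {i : Z ⟶ X} {p : X ⟶ Y} {w : i ≫ p = 0}
    (hS : (ShortComplex.mk i p w).ShortExact) :
    ∃ δ : Ext Y Z 1, (Ext.mk₀ p).comp δ (zero_add 1) = 0 ∧ δ.comp (Ext.mk₀ i) (add_zero 1) = 0 ∧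
      (∀ (W : ModuleCat.{u} Λ) (m k : ℕ) (h : m + 1 = k) (u : Ext W Z k),
        u.comp (Ext.mk₀ i) (add_zero k) = 0 → ∃ v : Ext W Y m, v.comp δ h = u) ∧
      (∀ (W : ModuleCat.{u} Λ) (m k : ℕ) (h : 1 + m = k) (u : Ext Y W k),
        (Ext.mk₀ p).comp u (zero_add k) = 0 → ∃ v : Ext Z W m, δ.comp v h = u) :=
  ⟨hS.extClass, hS.comp_extClass, hS.extClass_comp,
    fun W _ _ h u hu ↦ Ext.covariant_sequence_exact₁ W hS u hu h,
    fun W _ _ h u hu ↦ Ext.contravariant_sequence_exact₃ hS W u hu h⟩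

theorem shortExact_kernel {X Y : ModuleCat.{u} Λ} (p : X ⟶ Y) [Epi p] :
    (ShortComplex.mk (kernel.ι p) p (kernel.condition p)).ShortExact where
  exact := ShortComplex.exact_kernel p
  mono_f := inferInstanceAs (Mono (kernel.ι p))
  epi_g := inferInstanceAs (Epi p)

theorem shortExact_cokernel {X Y : ModuleCat.{u} Λ} (i : X ⟶ Y) [Mono i] :
    (ShortComplex.mk i (cokernel.π i) (cokernel.condition i)).ShortExact where
  exact := ShortComplex.exact_cokernel i
  mono_f := inferInstanceAs (Mono i)
  epi_g := inferInstanceAs (Epi (cokernel.π i))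

theorem finite_kernel [IsNoetherianRing Λ] {X Y : ModuleCat.{u} Λ} [Module.Finite Λ X]
    (p : X ⟶ Y) : Module.Finite Λ (kernel p : ModuleCat.{u} Λ) :=
  Module.Finite.of_injective (kernel.ι p).hom
    ((ModuleCat.mono_iff_injective (kernel.ι p)).1 inferInstance)

theorem finite_cokernel {X Y : ModuleCat.{u} Λ} [Module.Finite Λ Y]
    (i : X ⟶ Y) : Module.Finite Λ (cokernel i : ModuleCat.{u} Λ) :=
  Module.Finite.of_surjective (cokernel.π i).hom
    ((ModuleCat.epi_iff_surjective (cokernel.π i)).1 inferInstance)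

/-- The category of finitely generated modules has enough projectives. -/
theorem exists_epi_finite_projective (A : ModuleCat.{u} Λ) [Module.Finite Λ A] :
    ∃ (P : ModuleCat.{u} Λ) (p : P ⟶ A), Epi p ∧ Projective P ∧ Module.Finite Λ P := by
  obtain ⟨m, f, hf⟩ := Module.Finite.exists_fin' Λ A
  refine ⟨ModuleCat.of Λ (Fin m → Λ), ModuleCat.ofHom f,
    (ModuleCat.epi_iff_surjective _).2 hf, ?_, inferInstanceAs (Module.Finite Λ (Fin m → Λ))⟩
  exact (IsProjective.iff_projective (R := Λ) (P := (Fin m → Λ))).1 inferInstance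

/-! ### Cluster tilting subcategories and their (co)resolutions -/

namespace IsNClusterTilting

variable {n : ℕ} {M : ObjectProperty (ModuleCat.{u} Λ)} (hM : IsNClusterTilting n M)
include hM

theorem finite {X : ModuleCat.{u} Λ} (hX : M X) : Module.Finite Λ X := hM.le_isFG X hX

theorem subsingleton_ext {X Y : ModuleCat.{u} Λ} (hX : M X) (hY : M Y) {i : ℕ} (h0 : 0 < i)
    (hi : i < n) : Subsingleton (Ext X Y i) :=
  (hM.mem_iff_right Y (hM.finite hY)).1 hY X hX i h0 hi

theorem mem_of_projective (P : ModuleCat.{u} Λ) [Projective P] (hP : Module.Finite Λ P) : M P :=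
  (hM.mem_iff_left P hP).2 fun _ _ i h0 _ ↦ by
    obtain ⟨j, rfl⟩ := Nat.exists_eq_add_of_lt h0
    exact Ext.subsingleton_of_projective _ _ _

theorem mem_of_injective (I : ModuleCat.{u} Λ) [Injective I] (hI : Module.Finite Λ I) : M I :=
  (hM.mem_iff_right I hI).2 fun _ _ i h0 _ ↦ by
    obtain ⟨j, rfl⟩ := Nat.exists_eq_add_of_lt h0
    exact Ext.subsingleton_of_injective _ _ _

theorem mem_of_retract {A B : ModuleCat.{u} Λ} (hA : M A) (j : B ⟶ A) (s : A ⟶ B)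
    (h : j ≫ s = 𝟙 B) : M B := by
  have := hM.finite hA
  have hs : Function.Surjective s.hom := fun x ↦ ⟨j.hom x, ConcreteCategory.congr_hom h x⟩
  refine (hM.mem_iff_right B (Module.Finite.of_surjective s.hom hs)).2 fun Y hY i h0 hi ↦ ?_
  have := hM.subsingleton_ext hY hA h0 hi
  have hz : ∀ z : Ext Y B i, z = 0 := fun z ↦ by
    rw [← Ext.comp_mk₀_id z, ← h, ← Ext.mk₀_comp_mk₀, ← Ext.comp_assoc_of_third_deg_zero,
      Subsingleton.elim (z.comp (Ext.mk₀ j) (add_zero i)) 0, Ext.zero_comp]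
  exact ⟨fun x y ↦ (hz x).trans (hz y).symm⟩

theorem epi_of_isRightApprox {N X : ModuleCat.{u} Λ} (hX : Module.Finite Λ X) {π : N ⟶ X}
    (h : IsRightApprox M π) : Epi π := by
  obtain ⟨N', p, hN', hp⟩ := hM.generating X hX
  obtain ⟨g, rfl⟩ := h.2 N' hN' p
  exact epi_of_epi g π

theorem mono_of_isLeftApprox {N X : ModuleCat.{u} Λ} (hX : Module.Finite Λ X) {ι : X ⟶ N}
    (h : IsLeftApprox M ι) : Mono ι := by
  obtain ⟨N', i, hN', hi⟩ := hM.cogenerating X hX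
  obtain ⟨g, rfl⟩ := h.2 N' hN' i
  exact mono_of_mono ι g

/-- The class of a partial resolution `K ⟶ M' ⟶ ⋯ ⟶ A` of length `k` by objects of `M`. -/
theorem exists_resolution_class [IsNoetherianRing Λ] {A : ModuleCat.{u} Λ} (hA : M A) (k : ℕ)
    (hk : k + 1 ≤ n) :
    ∃ (K M' : ModuleCat.{u} Λ) (i : K ⟶ M') (ξ : Ext A K (k + 1)), Module.Finite Λ K ∧ M M' ∧
      (∀ Y, M Y → ∀ j, 0 < j → j < k + 1 → Subsingleton (Ext Y K j)) ∧
      ξ.comp (Ext.mk₀ i) (add_zero _) = 0 ∧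
      (∀ u : Ext A K (k + 1), u.comp (Ext.mk₀ i) (add_zero _) = 0 →
        ∃ f : A ⟶ A, (Ext.mk₀ f).comp ξ (zero_add _) = u) ∧
      (∀ X, M X → ∀ (l : ℕ) (h : k + 1 + l = n) (z : Ext A X n),
        ∃ w : Ext K X l, ξ.comp w h = z) := by
  induction k with
  | zero =>
    have := hM.finite hA
    -- A projective, not just an object of `M`: generation needs `Ext^n(P, X) = 0`, while `M` only
    -- gives vanishing below degree `n`.
    obtain ⟨P, p, hp, hP, hPf⟩ := exists_epi_finite_projective A
    obtain ⟨δ, hpδ, hδi, hδ₁, hδ₂⟩ := exists_extClass (shortExact_kernel p)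
    refine ⟨kernel p, P, kernel.ι p, δ, finite_kernel p, hM.mem_of_projective P hPf,
      fun Y hY j h0 h1 ↦ by lia, hδi, fun u hu ↦ ?_, fun X hX l h z ↦ ?_⟩
    · obtain ⟨v, hv⟩ := hδ₁ A _ _ (zero_add 1) u hu
      exact ⟨Ext.homEquiv₀ v, by rw [Ext.mk₀_homEquiv₀_apply]; exact hv⟩
    · refine hδ₂ X _ _ h z ?_
      obtain rfl : n = l + 1 := by lia
      exact Ext.eq_zero_of_projective _
  | succ k ih =>
    obtain ⟨K, M', i, ξ, hK, hM', hext, -, hlift, hgen⟩ := ih (by lia)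
    obtain ⟨N, π, hπ⟩ := hM.contravariantlyFinite K hK
    have := hM.epi_of_isRightApprox hK hπ
    have hN := hM.finite hπ.1
    obtain ⟨δ, hpδ, hδi, hδ₁, hδ₂⟩ := exists_extClass (shortExact_kernel π)
    refine ⟨kernel π, N, kernel.ι π, ξ.comp δ rfl, finite_kernel π, hπ.1,
      fun Y hY j h0 h1 ↦ ?_, ?_, fun u hu ↦ ?_, fun X hX l h z ↦ ?_⟩
    · have hz : ∀ z : Ext Y (kernel π) j, z = 0 := fun z ↦ by
        have := hM.subsingleton_ext hY hπ.1 h0 (by lia)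
        obtain ⟨j, rfl⟩ : ∃ j', j = j' + 1 := ⟨j - 1, by lia⟩
        -- Degree one vanishes because `π` is an approximation, higher degrees by dimension shift.
        obtain ⟨v, rfl⟩ := hδ₁ Y _ _ rfl z (Subsingleton.elim _ _)
        rcases Nat.eq_zero_or_pos j with rfl | hj
        · obtain ⟨g, hg⟩ := hπ.2 Y hY (Ext.homEquiv₀ v)
          rw [← Ext.mk₀_homEquiv₀_apply v, ← hg, ← Ext.mk₀_comp_mk₀,
            Ext.comp_assoc_of_second_deg_zero]
          rw [hpδ, Ext.comp_zero]
        · have := hext Y hY j hj (by lia)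
          rw [Subsingleton.elim v 0, Ext.zero_comp]
      exact ⟨fun x y ↦ (hz x).trans (hz y).symm⟩
    · rw [Ext.comp_assoc_of_third_deg_zero]
      rw [hδi, Ext.comp_zero]
    · obtain ⟨v, rfl⟩ := hδ₁ A _ _ rfl u hu
      -- `v` dies in `Ext^(k+1)(A, M')`, which is zero as `k + 1 < n`; so `hlift` applies to `v`.
      have := hM.subsingleton_ext hA hM' (Nat.succ_pos k) (by lia)
      obtain ⟨f, rfl⟩ := hlift v (Subsingleton.elim _ _)
      exact ⟨f, (Ext.comp_assoc _ _ _ _ _ (by lia)).symm⟩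
    · obtain ⟨w, rfl⟩ := hgen X hX (l + 1) (by lia) z
      have := hM.subsingleton_ext hπ.1 hX (Nat.succ_pos l) (by lia)
      obtain ⟨x, rfl⟩ := hδ₂ X _ _ (add_comm 1 l) w (Subsingleton.elim _ _)
      exact ⟨x, Ext.comp_assoc _ _ _ _ _ (by lia)⟩

/-- The class of a partial coresolution `A ⟶ ⋯ ⟶ M' ⟶ C` of length `k` by objects of `M`, over
an artin algebra. -/
theorem exists_coresolution_class (R : Type*) [CommRing R] [IsArtinianRing R] [Algebra R Λ]
    [Module.Finite R Λ] {A : ModuleCat.{u} Λ} (hA : M A) (k : ℕ) (hk : k + 1 ≤ n) :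
    ∃ (C M' : ModuleCat.{u} Λ) (p : M' ⟶ C) (ξ : Ext C A (k + 1)), Module.Finite Λ C ∧ M M' ∧
      (∀ Y, M Y → ∀ j, 0 < j → j < k + 1 → Subsingleton (Ext C Y j)) ∧
      (Ext.mk₀ p).comp ξ (zero_add _) = 0 ∧
      (∀ u : Ext C A (k + 1), (Ext.mk₀ p).comp u (zero_add _) = 0 →
        ∃ f : A ⟶ A, ξ.comp (Ext.mk₀ f) (add_zero _) = u) ∧
      (∀ X, M X → ∀ (l : ℕ) (h : l + (k + 1) = n) (z : Ext X A n),
        ∃ w : Ext X C l, w.comp ξ h = z) := by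
  induction k with
  | zero =>
    have := hM.finite hA
    -- An injective is needed for `Ext^n(X, I) = 0`.
    obtain ⟨I, i, hi, hI, hIf⟩ := exists_mono_finite_injective R A
    obtain ⟨δ, hpδ, hδi, hδ₁, hδ₂⟩ := exists_extClass (shortExact_cokernel i)
    refine ⟨cokernel i, I, cokernel.π i, δ, finite_cokernel i,
      hM.mem_of_injective I hIf,
      fun Y hY j h0 h1 ↦ by lia, hpδ, fun u hu ↦ ?_, fun X hX l h z ↦ ?_⟩
    · obtain ⟨v, hv⟩ := hδ₂ A _ _ (add_zero 1) u hu
      exact ⟨Ext.homEquiv₀ v, by rw [Ext.mk₀_homEquiv₀_apply]; exact hv⟩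
    · refine hδ₁ X _ _ h z ?_
      obtain rfl : n = l + 1 := by lia
      exact Ext.eq_zero_of_injective _
  | succ k ih =>
    obtain ⟨C, M', p, ξ, hC, hM', hext, -, hlift, hgen⟩ := ih (by lia)
    obtain ⟨N, ι, hι⟩ := hM.covariantlyFinite C hC
    have := hM.mono_of_isLeftApprox hC hι
    have hN := hM.finite hι.1
    obtain ⟨δ, hpδ, hδi, hδ₁, hδ₂⟩ := exists_extClass (shortExact_cokernel ι)
    refine ⟨cokernel ι, N, cokernel.π ι, δ.comp ξ (by lia), finite_cokernel ι, hι.1,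
      fun Y hY j h0 h1 ↦ ?_, ?_, fun u hu ↦ ?_, fun X hX l h z ↦ ?_⟩
    · have hz : ∀ z : Ext (cokernel ι) Y j, z = 0 := fun z ↦ by
        have := hM.subsingleton_ext hι.1 hY h0 (by lia)
        obtain ⟨j, rfl⟩ : ∃ j', j = 1 + j' := ⟨j - 1, by lia⟩
        obtain ⟨v, rfl⟩ := hδ₂ Y _ _ rfl z (Subsingleton.elim _ _)
        rcases Nat.eq_zero_or_pos j with rfl | hj
        · obtain ⟨g, hg⟩ := hι.2 Y hY (Ext.homEquiv₀ v)
          rw [← Ext.mk₀_homEquiv₀_apply v, ← hg, ← Ext.mk₀_comp_mk₀,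
            ← Ext.comp_assoc_of_third_deg_zero]
          rw [hδi, Ext.zero_comp]
        · have := hext Y hY j hj (by lia)
          rw [Subsingleton.elim v 0, Ext.comp_zero]
      exact ⟨fun x y ↦ (hz x).trans (hz y).symm⟩
    · rw [← Ext.comp_assoc _ _ _ (zero_add 1) _ (by lia), hpδ, Ext.zero_comp]
    · obtain ⟨v, rfl⟩ := hδ₂ A _ _ (add_comm 1 (k + 1)) u hu
      have := hM.subsingleton_ext hM' hA (Nat.succ_pos k) (by lia)
      obtain ⟨f, rfl⟩ := hlift v (Subsingleton.elim _ _)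
      exact ⟨f, Ext.comp_assoc _ _ _ _ _ (by lia)⟩
    · obtain ⟨w, rfl⟩ := hgen X hX (l + 1) (by lia) z
      have := hM.subsingleton_ext hX hι.1 (Nat.succ_pos l) (by lia)
      obtain ⟨x, rfl⟩ := hδ₁ X _ _ rfl w (Subsingleton.elim _ _)
      exact ⟨x, (Ext.comp_assoc _ _ _ _ _ (by lia)).symm⟩

end IsNClusterTilting

/-! ### Natural transformations between Ext functors -/

/-- The transformation `Ext^n(B, -) ⟶ Ext^n(A, -)` induced by a morphism `A ⟶ B`. -/
noncomputable def extFromMap (M : ObjectProperty (ModuleCat.{u} Λ)) (n : ℕ)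
    {A B : ModuleCat.{u} Λ} (f : A ⟶ B) : extFrom M n B ⟶ extFrom M n A :=
  Functor.whiskerLeft M.ι ((extFunctor.{u} n).map f.op)

/-- The transformation `Ext^n(-, A) ⟶ Ext^n(-, B)` induced by a morphism `A ⟶ B`. -/
noncomputable def extToMap (M : ObjectProperty (ModuleCat.{u} Λ)) (n : ℕ)
    {A B : ModuleCat.{u} Λ} (f : A ⟶ B) : extTo M n A ⟶ extTo M n B :=
  Functor.whiskerLeft M.ι.op ((extFunctor.{u} n).flip.map f)

theorem extFromMap_id (M : ObjectProperty (ModuleCat.{u} Λ)) (n : ℕ) (A : ModuleCat.{u} Λ) :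
    extFromMap M n (𝟙 A) = 𝟙 _ := by
  simp only [extFromMap, op_id, CategoryTheory.Functor.map_id]
  rfl

theorem extFromMap_comp (M : ObjectProperty (ModuleCat.{u} Λ)) (n : ℕ)
    {A B C : ModuleCat.{u} Λ} (f : A ⟶ B) (g : B ⟶ C) :
    extFromMap M n (f ≫ g) = extFromMap M n g ≫ extFromMap M n f := by
  simp only [extFromMap, op_comp, Functor.map_comp]
  rfl

theorem extToMap_id (M : ObjectProperty (ModuleCat.{u} Λ)) (n : ℕ) (A : ModuleCat.{u} Λ) :
    extToMap M n (𝟙 A) = 𝟙 _ := by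
  simp only [extToMap, CategoryTheory.Functor.map_id]
  rfl

theorem extToMap_comp (M : ObjectProperty (ModuleCat.{u} Λ)) (n : ℕ)
    {A B C : ModuleCat.{u} Λ} (f : A ⟶ B) (g : B ⟶ C) :
    extToMap M n (f ≫ g) = extToMap M n f ≫ extToMap M n g := by
  simp only [extToMap, Functor.map_comp]
  rfl

/-- The components of a transformation between functors `Ext^n(A, -)`. -/
noncomputable def extFromApp {M : ObjectProperty (ModuleCat.{u} Λ)} {n : ℕ}
    {A B : ModuleCat.{u} Λ} (η : extFrom M n A ⟶ extFrom M n B) {X : ModuleCat.{u} Λ} (hX : M X) :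
    Ext A X n →+ Ext B X n :=
  (η.app ⟨X, hX⟩).hom

theorem extFromApp_comp {M : ObjectProperty (ModuleCat.{u} Λ)} {n : ℕ}
    {A B : ModuleCat.{u} Λ} (η : extFrom M n A ⟶ extFrom M n B) {X Y : ModuleCat.{u} Λ} (hX : M X)
    (hY : M Y) (g : X ⟶ Y) (z : Ext A X n) :
    extFromApp η hY (z.comp (Ext.mk₀ g) (add_zero n)) =
      (extFromApp η hX z).comp (Ext.mk₀ g) (add_zero n) :=
  congrArg (fun φ : AddCommGrpCat.of (Ext A X n) ⟶ AddCommGrpCat.of (Ext B Y n) ↦ φ.hom z)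
    (η.naturality (X := ⟨X, hX⟩) (Y := ⟨Y, hY⟩) ⟨g⟩)

theorem eq_extFromMap {M : ObjectProperty (ModuleCat.{u} Λ)} {n : ℕ}
    {A B : ModuleCat.{u} Λ} (η : extFrom M n A ⟶ extFrom M n B) (f : B ⟶ A)
    (h : ∀ (X : ModuleCat.{u} Λ) (hX : M X) (z : Ext A X n),
      extFromApp η hX z = (Ext.mk₀ f).comp z (zero_add n)) : η = extFromMap M n f :=
  NatTrans.ext (funext fun X ↦ AddCommGrpCat.hom_ext (AddMonoidHom.ext fun z ↦
    h X.obj X.property z))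

/-- The components of a transformation between functors `Ext^n(-, A)`. -/
noncomputable def extToApp {M : ObjectProperty (ModuleCat.{u} Λ)} {n : ℕ}
    {A B : ModuleCat.{u} Λ} (η : extTo M n A ⟶ extTo M n B) {X : ModuleCat.{u} Λ} (hX : M X) :
    Ext X A n →+ Ext X B n :=
  (η.app (Opposite.op ⟨X, hX⟩)).hom

theorem comp_extToApp {M : ObjectProperty (ModuleCat.{u} Λ)} {n : ℕ}
    {A B : ModuleCat.{u} Λ} (η : extTo M n A ⟶ extTo M n B) {X Y : ModuleCat.{u} Λ} (hX : M X)
    (hY : M Y) (g : X ⟶ Y) (z : Ext Y A n) :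
    extToApp η hX ((Ext.mk₀ g).comp z (zero_add n)) =
      (Ext.mk₀ g).comp (extToApp η hY z) (zero_add n) :=
  congrArg (fun φ : AddCommGrpCat.of (Ext Y A n) ⟶ AddCommGrpCat.of (Ext X B n) ↦ φ.hom z)
    (η.naturality (X := Opposite.op ⟨Y, hY⟩) (Y := Opposite.op ⟨X, hX⟩) (Quiver.Hom.op ⟨g⟩))

theorem eq_extToMap {M : ObjectProperty (ModuleCat.{u} Λ)} {n : ℕ}
    {A B : ModuleCat.{u} Λ} (η : extTo M n A ⟶ extTo M n B) (f : A ⟶ B)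
    (h : ∀ (X : ModuleCat.{u} Λ) (hX : M X) (z : Ext X A n),
      extToApp η hX z = z.comp (Ext.mk₀ f) (add_zero n)) : η = extToMap M n f :=
  NatTrans.ext (funext fun X ↦ AddCommGrpCat.hom_ext (AddMonoidHom.ext fun z ↦
    h X.unop.obj X.unop.property z))

namespace IsNClusterTilting

variable {n : ℕ} {M : ObjectProperty (ModuleCat.{u} Λ)} (hM : IsNClusterTilting n M)
include hM

/-- Every endomorphism of `Ext^n(A, -)` on `M` is induced by an endomorphism of `A`. -/
theorem exists_eq_extFromMap [IsNoetherianRing Λ] (hn : 1 ≤ n) {A : ModuleCat.{u} Λ} (hA : M A)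
    (η : extFrom M n A ⟶ extFrom M n A) : ∃ f : A ⟶ A, η = extFromMap M n f := by
  obtain ⟨k, rfl⟩ : ∃ k, n = k + 1 := ⟨n - 1, by lia⟩
  obtain ⟨K, M', i, ξ, hK, hM', hext, hξ, hlift, hgen⟩ := hM.exists_resolution_class hA k le_rfl
  have hMK : M K := (hM.mem_iff_right K hK).2 hext
  -- By naturality along `i`, `η ξ` is killed by `i`, as `ξ` is.
  obtain ⟨f, hf⟩ := hlift (extFromApp η hMK ξ) (by
    rw [← extFromApp_comp η hMK hM', hξ, map_zero])
  refine ⟨f, eq_extFromMap η f fun X hX z ↦ ?_⟩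
  -- In degree zero `w` is a morphism `K ⟶ X`, so naturality carries the formula from `ξ` to `z`.
  obtain ⟨w, rfl⟩ := hgen X hX 0 rfl z
  rw [← Ext.mk₀_homEquiv₀_apply w, extFromApp_comp η hMK hX, ← hf,
    Ext.comp_assoc_of_third_deg_zero]

/-- Every endomorphism of `Ext^n(-, A)` on `M` is induced by an endomorphism of `A`, over an artin
algebra. -/
theorem exists_eq_extToMap (R : Type*) [CommRing R] [IsArtinianRing R] [Algebra R Λ]
    [Module.Finite R Λ] (hn : 1 ≤ n) {A : ModuleCat.{u} Λ} (hA : M A)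
    (η : extTo M n A ⟶ extTo M n A) : ∃ f : A ⟶ A, η = extToMap M n f := by
  obtain ⟨k, rfl⟩ : ∃ k, n = k + 1 := ⟨n - 1, by lia⟩
  obtain ⟨C, M', p, ξ, hC, hM', hext, hξ, hlift, hgen⟩ :=
    hM.exists_coresolution_class R hA k le_rfl
  have hMC : M C := (hM.mem_iff_left C hC).2 hext
  obtain ⟨f, hf⟩ := hlift (extToApp η hMC ξ) (by
    rw [← comp_extToApp η hM' hMC, hξ, map_zero])
  refine ⟨f, eq_extToMap η f fun X hX z ↦ ?_⟩
  obtain ⟨w, rfl⟩ := hgen X hX 0 (zero_add _) z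
  rw [← Ext.mk₀_homEquiv₀_apply w, comp_extToApp η hX hMC, ← hf,
    Ext.comp_assoc_of_third_deg_zero]

end IsNClusterTilting

end Modules

/-! ### Splitting the summand -/

/-- A direct summand is a retract. -/
theorem IsDirectSummand.exists_retract {C : Type*} [Category C] {F E : C ⥤ AddCommGrpCat.{u}}
    (h : IsDirectSummand F E) : ∃ (i : F ⟶ E) (r : E ⟶ F), i ≫ r = 𝟙 F := by
  obtain ⟨G, ⟨φ⟩⟩ := h
  exact ⟨biprod.inl ≫ φ.inv, φ.hom ≫ biprod.fst, by simp⟩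

end HigherCT

open HigherCT in
theorem mainTheorem6 {R : Type*} [CommRing R] [IsArtinianRing R]
    {Λ : Type u} [Ring Λ] [Algebra R Λ] [Module.Finite R Λ]
    (n : ℕ) (hn : 1 ≤ n)
    (M : ObjectProperty (ModuleCat.{u} Λ)) (hM : HigherCT.IsNClusterTilting n M)
    (A : ModuleCat.{u} Λ) (hA : M A) :
    (∀ F : M.FullSubcategory ⥤ AddCommGrpCat.{u},
      HigherCT.IsDirectSummand F (HigherCT.extFrom M n A) →
        ∃ B : ModuleCat.{u} Λ, M B ∧ Nonempty (F ≅ HigherCT.extFrom M n B)) ∧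
    (∀ F : M.FullSubcategoryᵒᵖ ⥤ AddCommGrpCat.{u},
      HigherCT.IsDirectSummand F (HigherCT.extTo M n A) →
        ∃ B : ModuleCat.{u} Λ, M B ∧ Nonempty (F ≅ HigherCT.extTo M n B)) := by
  have := isArtinianRing_of_finite R Λ
  have := isNoetherianRing_of_finite R Λ
  have := hM.finite hA
  refine ⟨fun F hF ↦ ?_, fun F hF ↦ ?_⟩
  · obtain ⟨i, r, hir⟩ := hF.exists_retract
    obtain ⟨f, hf⟩ := hM.exists_eq_extFromMap hn hA (r ≫ i)
    obtain ⟨g, e, b, hg, hee, hgb, hbg, hge, -⟩ := exists_idempotent_factor A f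
      (fun g ↦ extFromMap M n g = r ≫ i) hf.symm fun g h ↦ by
        rw [extFromMap_comp, h, ← hf]; simp [reassoc_of% hir]
    obtain ⟨B, j, s, hjs, hsj⟩ := IsIdempotentComplete.idempotents_split A e hee
    refine ⟨B, hM.mem_of_retract hA j s hjs, ⟨isoOfSplittings i r (extFromMap M n s)
      (extFromMap M n j) hir ?_ ?_⟩⟩
    · rw [← extFromMap_comp, hjs, extFromMap_id]
    · rw [← extFromMap_comp, hsj]
      -- Write `ε = r ≫ i` and `T = extFromMap M n`. Then `T e ≫ ε = ε` and `T b ≫ ε = T e`, so `ε ≫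
      -- ε = ε` gives `T e = T e ≫ ε = ε`.
      have h1 : extFromMap M n e ≫ (r ≫ i) = r ≫ i := by
        rw [← hg, ← extFromMap_comp, hge]
      have h2 : extFromMap M n b ≫ (r ≫ i) = extFromMap M n e := by
        rw [← hg, ← extFromMap_comp, hgb]
      rw [← h1, ← h2]
      simp [reassoc_of% hir]
  · obtain ⟨i, r, hir⟩ := hF.exists_retract
    obtain ⟨f, hf⟩ := hM.exists_eq_extToMap R hn hA (r ≫ i)
    obtain ⟨g, e, b, hg, hee, hgb, hbg, hge, heg⟩ := exists_idempotent_factor A f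
      (fun g ↦ extToMap M n g = r ≫ i) hf.symm fun g h ↦ by
        rw [extToMap_comp, h, ← hf]; simp [reassoc_of% hir]
    obtain ⟨B, j, s, hjs, hsj⟩ := IsIdempotentComplete.idempotents_split A e hee
    refine ⟨B, hM.mem_of_retract hA j s hjs, ⟨isoOfSplittings i r (extToMap M n j)
      (extToMap M n s) hir ?_ ?_⟩⟩
    · rw [← extToMap_comp, hjs, extToMap_id]
    · rw [← extToMap_comp, hsj]
      have h1 : extToMap M n e ≫ (r ≫ i) = r ≫ i := by
        rw [← hg, ← extToMap_comp, heg]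
      have h2 : extToMap M n b ≫ (r ≫ i) = extToMap M n e := by
        rw [← hg, ← extToMap_comp, hbg]
      rw [← h1, ← h2]
      simp [reassoc_of% hir]
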